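/- Let $R$ be a simple artinian ring. Then $R\cong M_n(D)$ for some division ring $D$ and some integer $n\ge 1$. Moreover, for every division ring $D$ and every $n$ with $R\cong M_n(D)$ as rings: (a) if $D$ is commutative, then there exists an additive closed symmetric monoidal structure on the category of left $R$-modules, and any two such structures are equivalent; (b) if $D$ is not commutative, then there is no additive closed symmetric monoidal structure on the category of left $R$-modules. Here an additive closed symmetric monoidal structure on the category of left $R$-modules is a symmetric monoidal structure $(\wedge, K)$ whose product $\wedge$ is additive in both variables and such that every functor $A\wedge -$ has a right adjoint. Two such structures $(\wedge,K)$ and $(\Box,K')$ are equivalent if there are an additive functor $F$ from the category of left $R$-modules to itself that is an equivalence of categories and natural isomorphisms $FM\mathbin{\Box} FN\cong F(M\wedge N)$ and $K'\cong FK$ that are compatible with the associativity, unit and commutativity isomorphisms. -/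

import Mathlib

open CategoryTheory

universe u v

/-- An additive closed symmetric monoidal structure on a preadditive category `C`:
a symmetric monoidal structure on `C` (unit, product, associativity, unit and commutativity
isomorphisms, with all coherence axioms) whose product is additive in both variables and
for which every functor `X ⊗ -` has a right adjoint. -/
structure AdditiveClosedSymmetricMonoidal (C : Type u) [Category.{v} C] [Preadditive C] where
  /-- the underlying monoidal structure -/
  monoidal : MonoidalCategory.{v} C
  /-- the symmetric braiding -/
  symmetric : SymmetricCategory C
  /-- the product is additive in both variables -/
  additive : MonoidalPreadditive C
  /-- internal homs exist -/
  closed : Nonempty (MonoidalClosed C)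

/-- Two additive closed symmetric monoidal structures `S` and `T` on `C` are equivalent if there is
an additive equivalence of categories `F : C ⥤ C` which carries a strong symmetric monoidal
structure from `(C, S)` to `(C, T)`. (A quasi-inverse of `F` is then again additive and strong
symmetric monoidal, compatibly with the unit and the counit of the equivalence.) -/
def AdditiveClosedSymmetricMonoidal.Equivalent {C : Type u} [Category.{v} C] [Preadditive C]
    (S T : AdditiveClosedSymmetricMonoidal C) : Prop :=
  ∃ F : C ⥤ C, F.IsEquivalence ∧ F.Additive ∧
    Nonempty (@Functor.Braided C _ S.monoidal S.symmetric.toBraidedCategory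
      C _ T.monoidal T.symmetric.toBraidedCategory F)

/-! By Wedderburn–Artin and Morita theory, `R`-modules are equivalent to vector spaces over `D`. The
unit of an additive monoidal structure has commuting endomorphisms (Eckmann–Hilton) and is nonzero,
since a zero unit kills every object. A nonzero `D`-vector space with commuting endomorphisms is a
line and forces `D` to be commutative. This gives (b), and in (a) it makes any two units isomorphic
to the image of `D`, which is a generator. Because the product is closed and the unit generates,
maps out of `X ⊗ Y` are exactly the biadditive, `End`-bilinear pairings of points `𝟙_ C ⟶ X` and `𝟙_
C ⟶ Y` (`tensorHom_hom_ext`, `exists_tensorHom_comp_eq`). Hence an isomorphism of units determines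
the comparison of two products, and coherence is checked on points. Existence comes from
transporting the tensor product over `D`. -/

open MonoidalCategory Limits

universe w v₁ v₂ u₁ u₂

/-! ### Scalars: endomorphisms of the unit -/

section Unit

variable {C : Type u₁} [Category.{v₁} C] [MonoidalCategory C]

/-- Scalars leave either tensor factor by naturality of a unitor; on the left factor this uses that
the two unitors agree at the unit. -/
lemma leftUnitor_inv_comp_tensorHom_left (s : 𝟙_ C ⟶ 𝟙_ C) {X Y : C} (a : 𝟙_ C ⟶ X)
    (b : 𝟙_ C ⟶ Y) : (λ_ (𝟙_ C)).inv ≫ ((s ≫ a) ⊗ₘ b) = s ≫ (λ_ (𝟙_ C)).inv ≫ (a ⊗ₘ b) := by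
  rw [unitors_inv_equal, ← whiskerRight_comp_tensorHom, ← rightUnitor_inv_naturality_assoc]

lemma leftUnitor_inv_comp_tensorHom_right (s : 𝟙_ C ⟶ 𝟙_ C) {X Y : C} (a : 𝟙_ C ⟶ X)
    (b : 𝟙_ C ⟶ Y) : (λ_ (𝟙_ C)).inv ≫ (a ⊗ₘ (s ≫ b)) = s ≫ (λ_ (𝟙_ C)).inv ≫ (a ⊗ₘ b) := by
  rw [← whiskerLeft_comp_tensorHom, ← leftUnitor_inv_naturality_assoc]

/-- Endomorphisms of the unit object commute (Eckmann–Hilton). -/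
lemma tensorUnit_hom_comm (s t : 𝟙_ C ⟶ 𝟙_ C) : s ≫ t = t ≫ s := by
  -- `s ⊗ t` is evaluated twice, extracting `s` first and then `t` first.
  have h₁ := leftUnitor_inv_comp_tensorHom_left s (𝟙 _) t
  have h₂ := leftUnitor_inv_comp_tensorHom_right t s (𝟙 _)
  rw [Category.comp_id, id_tensorHom, ← leftUnitor_inv_naturality] at h₁
  rw [Category.comp_id, tensorHom_id, unitors_inv_equal, ← rightUnitor_inv_naturality,
    ← unitors_inv_equal] at h₂
  simpa using (h₁.symm.trans h₂) =≫ (λ_ _).hom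

end Unit

/-! ### Tensor products when the unit is a generator -/

section Generator

variable {C : Type u₁} [Category.{v₁} C] [MonoidalCategory C] [MonoidalClosed C]

/-- Currying turns the claim into one about maps out of `Y`, which points of `Y` separate. -/
lemma whiskerLeft_hom_ext (hC : IsSeparator (𝟙_ C)) {X Y Z : C} {f g : X ⊗ Y ⟶ Z}
    (h : ∀ b : 𝟙_ C ⟶ Y, X ◁ b ≫ f = X ◁ b ≫ g) : f = g := by
  apply MonoidalClosed.curry_injective
  refine hC.def _ _ fun b => ?_
  rw [← MonoidalClosed.curry_natural_left, ← MonoidalClosed.curry_natural_left, h]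

lemma tensorHom_hom_ext (hC : IsSeparator (𝟙_ C)) {X Y Z : C} {f g : X ⊗ Y ⟶ Z}
    (h : ∀ (a : 𝟙_ C ⟶ X) (b : 𝟙_ C ⟶ Y), (a ⊗ₘ b) ≫ f = (a ⊗ₘ b) ≫ g) : f = g := by
  refine whiskerLeft_hom_ext hC fun b => ?_
  rw [← cancel_epi (ρ_ X).inv]
  refine hC.def _ _ fun a => ?_
  rw [rightUnitor_inv_naturality_assoc, rightUnitor_inv_naturality_assoc,
    ← MonoidalCategory.tensorHom_def_assoc, ← MonoidalCategory.tensorHom_def_assoc, h]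

lemma tensorHom_tensorHom_hom_ext (hC : IsSeparator (𝟙_ C)) {X Y Z W : C} {f g : (X ⊗ Y) ⊗ Z ⟶ W}
    (h : ∀ (a : 𝟙_ C ⟶ X) (b : 𝟙_ C ⟶ Y) (c : 𝟙_ C ⟶ Z),
      ((a ⊗ₘ b) ⊗ₘ c) ≫ f = ((a ⊗ₘ b) ⊗ₘ c) ≫ g) : f = g := by
  refine whiskerLeft_hom_ext hC fun c => ?_
  rw [← cancel_epi (ρ_ (X ⊗ Y)).inv]
  refine tensorHom_hom_ext hC fun a b => ?_
  rw [rightUnitor_inv_naturality_assoc, rightUnitor_inv_naturality_assoc,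
    ← MonoidalCategory.tensorHom_def_assoc, ← MonoidalCategory.tensorHom_def_assoc, h]

variable [Preadditive C] [MonoidalPreadditive C]

lemma MonoidalClosed.curry_add {X Y Z : C} (f g : X ⊗ Y ⟶ Z) :
    MonoidalClosed.curry (f + g) = MonoidalClosed.curry f + MonoidalClosed.curry g := by
  apply MonoidalClosed.uncurry_injective
  rw [MonoidalClosed.uncurry_curry, MonoidalClosed.uncurry_eq, MonoidalPreadditive.whiskerLeft_add,
    Preadditive.add_comp, ← MonoidalClosed.uncurry_eq, ← MonoidalClosed.uncurry_eq,
    MonoidalClosed.uncurry_curry, MonoidalClosed.uncurry_curry]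

/-- The object `G` is dense in `C`: additive maps `Hom(G, X) → Hom(G, Z)` that are equivariant
for `End G` come from morphisms `X ⟶ Z`. -/
def IsFullGenerator (G : C) : Prop :=
  ∀ ⦃X Z : C⦄ (φ : (G ⟶ X) → (G ⟶ Z)), (∀ a b, φ (a + b) = φ a + φ b) →
    (∀ (s : G ⟶ G) a, φ (s ≫ a) = s ≫ φ a) → ∃ f : X ⟶ Z, ∀ a, a ≫ f = φ a

/-- The universal property of the tensor product in terms of `𝟙_ C`-points. -/
lemma exists_tensorHom_comp_eq (hC : IsSeparator (𝟙_ C)) (hC' : IsFullGenerator (𝟙_ C)) {X Y Z : C}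
    (Φ : (𝟙_ C ⟶ X) → (𝟙_ C ⟶ Y) → (𝟙_ C ⟶ Z))
    (add_left : ∀ a a' b, Φ (a + a') b = Φ a b + Φ a' b)
    (add_right : ∀ a b b', Φ a (b + b') = Φ a b + Φ a b')
    (comp_left : ∀ (s : 𝟙_ C ⟶ 𝟙_ C) a b, Φ (s ≫ a) b = s ≫ Φ a b)
    (comp_right : ∀ (s : 𝟙_ C ⟶ 𝟙_ C) a b, Φ a (s ≫ b) = s ≫ Φ a b) :
    ∃ f : X ⊗ Y ⟶ Z, ∀ a b, (a ⊗ₘ b) ≫ f = (λ_ (𝟙_ C)).hom ≫ Φ a b := by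
  choose h hh using fun b => hC' (fun a => Φ a b) (fun a a' => add_left a a' b)
    (fun s a => comp_left s a b)
  -- Density is used a second time, now in the variable `b`, with the internal hom as target.
  obtain ⟨g, hg⟩ := hC' (fun b => MonoidalClosed.curry ((ρ_ X).hom ≫ h b))
    (fun b b' => by
      rw [← MonoidalClosed.curry_add, ← Preadditive.comp_add]
      congr 2
      refine hC.def _ _ fun a => ?_
      rw [Preadditive.comp_add, hh, hh, hh, add_right])
    (fun s b => by
      rw [← MonoidalClosed.curry_natural_left]
      congr 1
      rw [← cancel_epi (ρ_ X).inv]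
      refine hC.def _ _ fun a => ?_
      rw [Iso.inv_hom_id_assoc, hh, comp_right, rightUnitor_inv_naturality_assoc,
        ← whisker_exchange_assoc, rightUnitor_naturality_assoc, hh, ← unitors_equal,
        ← unitors_inv_equal, ← leftUnitor_inv_naturality_assoc, Iso.inv_hom_id_assoc])
  refine ⟨MonoidalClosed.uncurry g, fun a b => ?_⟩
  rw [MonoidalCategory.tensorHom_def, Category.assoc, ← MonoidalClosed.uncurry_natural_left, hg,
    MonoidalClosed.uncurry_curry, rightUnitor_naturality_assoc, hh, unitors_equal]

end Generator

/-! ### Monoidal structure on an equivalence that matches units -/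

section Tensorator

variable {C : Type u₁} [Category.{v₁} C] [MonoidalCategory C]
  {D : Type u₂} [Category.{v₂} D] [MonoidalCategory D]
  (F : C ⥤ D) (e : 𝟙_ D ≅ F.obj (𝟙_ C))

/-- A morphism `F X ⊗ F Y ⟶ F (X ⊗ Y)` is compatible with the tensor product of points. -/
def IsTensorator {X Y : C} (m : F.obj X ⊗ F.obj Y ⟶ F.obj (X ⊗ Y)) : Prop :=
  ∀ (a : 𝟙_ C ⟶ X) (b : 𝟙_ C ⟶ Y), ((e.hom ≫ F.map a) ⊗ₘ (e.hom ≫ F.map b)) ≫ m =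
    (λ_ (𝟙_ D)).hom ≫ e.hom ≫ F.map ((λ_ (𝟙_ C)).inv ≫ (a ⊗ₘ b))

variable {F} in
lemma exists_point_eq [F.Full] {X : C} (a : 𝟙_ D ⟶ F.obj X) :
    ∃ a' : 𝟙_ C ⟶ X, e.hom ≫ F.map a' = a :=
  ⟨F.preimage (e.inv ≫ a), by simp⟩

variable {F e} in
lemma IsTensorator.eq_of_comp [MonoidalClosed D] [F.Full] (hD : IsSeparator (𝟙_ D)) {X Y : C} {Z : D}
    {f g : F.obj X ⊗ F.obj Y ⟶ Z}
    (h : ∀ (a : 𝟙_ C ⟶ X) (b : 𝟙_ C ⟶ Y), ((e.hom ≫ F.map a) ⊗ₘ (e.hom ≫ F.map b)) ≫ f =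
      ((e.hom ≫ F.map a) ⊗ₘ (e.hom ≫ F.map b)) ≫ g) : f = g := by
  refine tensorHom_hom_ext hD fun a b => ?_
  obtain ⟨a, rfl⟩ := exists_point_eq e a
  obtain ⟨b, rfl⟩ := exists_point_eq e b
  exact h a b

variable [MonoidalClosed D] [Preadditive C] [MonoidalPreadditive C] [Preadditive D]
  [MonoidalPreadditive D]

/-- Since `F` is fully faithful and matches units, points of `F.obj X` are points of `X`; tensoring
these is a bilinear pairing, so it is represented by a map. -/
lemma exists_isTensorator [F.Full] [F.Faithful] [F.Additive] (hD : IsSeparator (𝟙_ D))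
    (hD' : IsFullGenerator (𝟙_ D)) (X Y : C) :
    ∃ m : F.obj X ⊗ F.obj Y ⟶ F.obj (X ⊗ Y), IsTensorator F e m := by
  let p {X : C} (a : 𝟙_ D ⟶ F.obj X) : 𝟙_ C ⟶ X := F.preimage (e.inv ≫ a)
  have p_add {X : C} (a b : 𝟙_ D ⟶ F.obj X) : p (a + b) = p a + p b :=
    F.map_injective (by simp [p, F.map_add])
  have p_comp {X : C} (s : 𝟙_ D ⟶ 𝟙_ D) (a : 𝟙_ D ⟶ F.obj X) :
      p (s ≫ a) = p (s ≫ e.hom) ≫ p a := F.map_injective (by simp [p])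
  have p_map (s : 𝟙_ D ⟶ 𝟙_ D) : e.hom ≫ F.map (p (s ≫ e.hom)) = s ≫ e.hom := by simp [p]
  have p_point {X : C} (a : 𝟙_ C ⟶ X) : p (e.hom ≫ F.map a) = a := F.map_injective (by simp [p])
  obtain ⟨m, hm⟩ := exists_tensorHom_comp_eq hD hD'
    (fun a b => e.hom ≫ F.map ((λ_ (𝟙_ C)).inv ≫ (p (X := X) a ⊗ₘ p (X := Y) b)))
    (fun a a' b => by
      simp [p_add, MonoidalPreadditive.add_tensor, F.map_add, -Functor.map_comp])
    (fun a b b' => by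
      simp [p_add, MonoidalPreadditive.tensor_add, F.map_add, -Functor.map_comp])
    (fun s a b => by
      rw [p_comp, leftUnitor_inv_comp_tensorHom_left, F.map_comp, reassoc_of% (p_map s)])
    (fun s a b => by
      rw [p_comp, leftUnitor_inv_comp_tensorHom_right, F.map_comp, reassoc_of% (p_map s)])
  exact ⟨m, fun a b => by rw [hm, p_point, p_point]⟩

variable {F e} in
lemma isIso_of_isTensorator [MonoidalClosed C] [F.IsEquivalence] [F.Additive] (hD : IsSeparator (𝟙_ D))
    (hC : IsSeparator (𝟙_ C)) (hC' : IsFullGenerator (𝟙_ C)) {X Y : C}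
    {m : F.obj X ⊗ F.obj Y ⟶ F.obj (X ⊗ Y)} (hm : IsTensorator F e m) : IsIso m := by
  -- The inverse comes from the universal property in `C`, applied to a preimage of `F.obj X ⊗ F.obj
  -- Y` under `F`.
  let i := F.objObjPreimageIso (F.obj X ⊗ F.obj Y)
  obtain ⟨d, hd⟩ := exists_tensorHom_comp_eq hC hC'
    (fun (a : 𝟙_ C ⟶ X) (b : 𝟙_ C ⟶ Y) => F.preimage (e.inv ≫ (λ_ (𝟙_ D)).inv ≫
      ((e.hom ≫ F.map a) ⊗ₘ (e.hom ≫ F.map b)) ≫ i.inv))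
    (fun a a' b => F.map_injective (by
      simp [F.map_add, MonoidalPreadditive.add_tensor]))
    (fun a b b' => F.map_injective (by
      simp [F.map_add, MonoidalPreadditive.tensor_add]))
    (fun s a b => F.map_injective (by
      have := leftUnitor_inv_comp_tensorHom_left (e.hom ≫ F.map s ≫ e.inv) (e.hom ≫ F.map a)
        (e.hom ≫ F.map b)
      simp only [Category.assoc, Iso.inv_hom_id_assoc] at this
      simp [reassoc_of% this]))
    (fun s a b => F.map_injective (by
      have := leftUnitor_inv_comp_tensorHom_right (e.hom ≫ F.map s ≫ e.inv) (e.hom ≫ F.map a)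
        (e.hom ≫ F.map b)
      simp only [Category.assoc, Iso.inv_hom_id_assoc] at this
      simp [reassoc_of% this]))
  have key (a : 𝟙_ C ⟶ X) (b : 𝟙_ C ⟶ Y) :
      ((e.hom ≫ F.map a) ⊗ₘ (e.hom ≫ F.map b)) ≫ m ≫ F.map d ≫ i.hom =
        (e.hom ≫ F.map a) ⊗ₘ (e.hom ≫ F.map b) := by
    rw [reassoc_of% (hm a b), ← F.map_comp_assoc, Category.assoc, hd]
    simp
  have h₁ : m ≫ F.map d ≫ i.hom = 𝟙 _ := by
    refine tensorHom_hom_ext hD fun a b => ?_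
    obtain ⟨a, rfl⟩ := exists_point_eq e a
    obtain ⟨b, rfl⟩ := exists_point_eq e b
    rw [key, Category.comp_id]
  refine ⟨F.map d ≫ i.hom, h₁, ?_⟩
  -- Fullness moves the other composite back to `C`, where points separate maps out of `X ⊗ Y`.
  obtain ⟨w, hw⟩ := F.map_surjective ((F.map d ≫ i.hom) ≫ m)
  rw [← hw, ← F.map_id]
  congr 1
  refine tensorHom_hom_ext hC fun a b => ?_
  have h₂ := hm a b =≫ (F.map d ≫ i.hom ≫ m)
  rw [Category.assoc, reassoc_of% h₁, hm] at h₂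
  simp only [cancel_epi, Category.assoc] at h₂
  have h₃ : (λ_ (𝟙_ C)).inv ≫ (a ⊗ₘ b) ≫ w = (λ_ (𝟙_ C)).inv ≫ (a ⊗ₘ b) := by
    apply F.map_injective
    rw [← Category.assoc, F.map_comp, hw]
    simpa only [Category.assoc] using h₂.symm
  simpa using h₃

/-- An additive equivalence that matches the units is strong monoidal, if the units are dense
generators. -/
noncomputable def coreMonoidalOfUnitIso [F.IsEquivalence] [F.Additive]
    (m : ∀ X Y, F.obj X ⊗ F.obj Y ≅ F.obj (X ⊗ Y)) (hm : ∀ X Y, IsTensorator F e (m X Y).hom)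
    (hD : IsSeparator (𝟙_ D)) : F.CoreMonoidal where
  εIso := e
  μIso := m
  μIso_hom_natural_left f Z := by
    refine IsTensorator.eq_of_comp (e := e) hD fun a b => ?_
    rw [reassoc_of% (hm _ _ a b), tensorHom_comp_whiskerRight_assoc, Category.assoc, ← F.map_comp,
      hm, ← F.map_comp, Category.assoc, tensorHom_comp_whiskerRight]
  μIso_hom_natural_right Z f := by
    refine IsTensorator.eq_of_comp (e := e) hD fun a b => ?_
    rw [reassoc_of% (hm _ _ a b), tensorHom_comp_whiskerLeft_assoc, Category.assoc, ← F.map_comp,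
      hm, ← F.map_comp, Category.assoc, tensorHom_comp_whiskerLeft]
  associativity X Y Z := by
    refine tensorHom_tensorHom_hom_ext hD fun a b c => ?_
    obtain ⟨a, rfl⟩ := exists_point_eq e a
    obtain ⟨b, rfl⟩ := exists_point_eq e b
    obtain ⟨c, rfl⟩ := exists_point_eq e c
    have h₁ := hm _ _ ((λ_ (𝟙_ C)).inv ≫ (a ⊗ₘ b)) c
    have h₂ := hm _ _ a ((λ_ (𝟙_ C)).inv ≫ (b ⊗ₘ c))
    rw [tensorHom_comp_whiskerRight_assoc, hm, associator_naturality_assoc,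
      tensorHom_comp_whiskerLeft_assoc, hm,
      ← whiskerRight_comp_tensorHom_assoc (λ_ (𝟙_ D)).hom (e.hom ≫ F.map _),
      ← whiskerLeft_comp_tensorHom_assoc _ (λ_ (𝟙_ D)).hom (e.hom ≫ F.map _),
      reassoc_of% h₁, h₂, ← F.map_comp, ← whiskerRight_comp_tensorHom,
      ← whiskerLeft_comp_tensorHom]
    simp only [Category.assoc, associator_naturality]
    -- On points, only coherence between copies of the unit remains.
    have h₃ : (λ_ (𝟙_ C)).inv ≫ (λ_ (𝟙_ C)).inv ▷ 𝟙_ C ≫ (α_ _ _ _).hom =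
        (λ_ (𝟙_ C)).inv ≫ 𝟙_ C ◁ (λ_ (𝟙_ C)).inv := by monoidal
    have h₄ : (λ_ (𝟙_ D)).hom ▷ 𝟙_ D = (α_ _ _ _).hom ≫ 𝟙_ D ◁ (λ_ (𝟙_ D)).hom := by monoidal
    rw [reassoc_of% h₃, h₄, Category.assoc]
  left_unitality X := by
    refine whiskerLeft_hom_ext hD fun b => ?_
    obtain ⟨b, rfl⟩ := exists_point_eq e b
    have h := hm _ _ (𝟙 _) b
    rw [F.map_id, Category.comp_id] at h
    rw [← MonoidalCategory.tensorHom_def'_assoc, reassoc_of% h, ← F.map_comp]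
    simp
  right_unitality X := by
    rw [← cancel_epi (ρ_ _).inv]
    refine hD.def _ _ fun a => ?_
    obtain ⟨a, rfl⟩ := exists_point_eq e a
    have h := hm _ _ a (𝟙 _)
    rw [F.map_id, Category.comp_id] at h
    rw [rightUnitor_inv_naturality_assoc, rightUnitor_inv_naturality_assoc,
      ← MonoidalCategory.tensorHom_def_assoc, reassoc_of% h, ← F.map_comp]
    simp [unitors_inv_equal, unitors_equal]

theorem nonempty_braided_of_unitIso (e : 𝟙_ D ≅ F.obj (𝟙_ C)) [MonoidalClosed C]
    [SymmetricCategory C] [SymmetricCategory D] [F.IsEquivalence]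
    [F.Additive] (hC : IsSeparator (𝟙_ C)) (hC' : IsFullGenerator (𝟙_ C))
    (hD : IsSeparator (𝟙_ D)) (hD' : IsFullGenerator (𝟙_ D)) : Nonempty F.Braided := by
  choose m hm using exists_isTensorator F e hD hD'
  have (X Y : C) : IsIso (m X Y) := isIso_of_isTensorator hD hC hC' (hm X Y)
  let c := coreMonoidalOfUnitIso F e (fun X Y => asIso (m X Y)) hm hD
  refine ⟨{ c.toMonoidal with braided := fun X Y => ?_ }⟩
  change m X Y ≫ F.map (β_ X Y).hom = (β_ (F.obj X) (F.obj Y)).hom ≫ m Y X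
  refine IsTensorator.eq_of_comp (e := e) hD fun a b => ?_
  rw [reassoc_of% (hm _ _ a b), BraidedCategory.braiding_naturality_assoc, hm, ← F.map_comp]
  simp [unitors_inv_equal, unitors_equal]

end Tensorator

/-- This is the fullness part of the Gabriel–Popescu theorem: `φ` is a linear map of modules over
`(End G)ᵐᵒᵖ`. -/
lemma isFullGenerator_of_isSeparator {C : Type u₁} [Category.{v₁} C] [Abelian C]
    [IsGrothendieckAbelian.{v₁} C] {G : C} (hG : IsSeparator G) : IsFullGenerator G := by
  intro X Z φ hadd hsmul
  have := IsGrothendieckAbelian.GabrielPopescu.full G hG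
  let ψ : (preadditiveCoyonedaObj G).obj X ⟶ (preadditiveCoyonedaObj G).obj Z :=
    ModuleCat.ofHom { toFun := φ, map_add' := hadd, map_smul' := fun s a => hsmul s.unop a }
  obtain ⟨f, hf⟩ := (preadditiveCoyonedaObj G).map_surjective ψ
  exact ⟨f, fun a => congr($hf a)⟩

/-! ### Identifying the unit object -/

section UnitOfModules

lemma ModuleCat.isSeparator_self (R : Type w) [Ring R] : IsSeparator (ModuleCat.of R R) := by
  refine (isSeparator_def _).2 fun X Y f g h => ?_
  ext x
  simpa using congr(($(h (ModuleCat.ofHom (LinearMap.toSpanSingleton R X x)))).hom 1)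

lemma CategoryTheory.IsSeparator.of_iso {C : Type u₁} [Category.{v₁} C] {G H : C}
    (hG : IsSeparator G) (i : G ≅ H) : IsSeparator H :=
  (isSeparator_def _).2 fun _ _ _ _ h => hG.def _ _ fun a => by
    simpa using i.hom ≫= h (i.inv ≫ a)

lemma isZero_of_isZero_tensorUnit {C : Type u₁} [Category.{v₁} C] [Preadditive C]
    [MonoidalCategory C] [MonoidalPreadditive C] (h : IsZero (𝟙_ C)) (X : C) : IsZero X := by
  refine IsZero.of_iso ?_ (λ_ X).symm
  rw [IsZero.iff_id_eq_zero, ← id_whiskerRight, h.eq_of_src (𝟙 (𝟙_ C)) 0,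
    MonoidalPreadditive.zero_whiskerRight]

variable {K : Type w} [DivisionRing K]

/-- A nonzero vector space with commuting endomorphisms is one-dimensional over a commutative
field. -/
lemma mul_comm_and_nonempty_linearEquiv_of_commute {V : Type w} [AddCommGroup V] [Module K V]
    [Nontrivial V] (h : ∀ f g : V →ₗ[K] V, f ∘ₗ g = g ∘ₗ f) :
    (∀ x y : K, x * y = y * x) ∧ Nonempty (K ≃ₗ[K] V) := by
  obtain ⟨v, hv⟩ := exists_ne (0 : V)
  have hinj : Function.Injective (LinearMap.toSpanSingleton K V v) :=
    LinearMap.ker_eq_bot.1 (LinearMap.ker_toSpanSingleton K hv)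
  obtain ⟨f, hf⟩ := LinearMap.exists_leftInverse_of_injective _ (LinearMap.ker_eq_bot.2 hinj)
  have hfv : f v = 1 := by simpa using LinearMap.congr_fun hf 1
  -- The rank-one endomorphisms `f(-) • x` and `f(-) • y` commute; evaluate at `v`, where `f v = 1`.
  have key (x y : V) : f y • x = f x • y := by
    have := LinearMap.congr_fun (h (f.smulRight x) (f.smulRight y)) v
    simpa [hfv] using this
  refine ⟨fun x y => ?_, ⟨LinearEquiv.ofBijective _ ⟨hinj, fun x => ⟨f x, ?_⟩⟩⟩⟩
  · apply hinj
    have := key (y • v) (x • v)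
    simpa [hfv, mul_smul] using this
  · simpa [hfv] using (key x v).symm

variable {C : Type u₁} [Category.{v₁} C] [Preadditive C] [MonoidalCategory C]
  [MonoidalPreadditive C]

/-- The unit corresponds to a vector space over `K` that is nonzero, as otherwise `K` itself would
vanish, and whose endomorphisms commute. -/
theorem mul_comm_and_nonempty_tensorUnit_iso (e : ModuleCat.{w} K ≌ C) :
    (∀ x y : K, x * y = y * x) ∧ Nonempty (𝟙_ C ≅ e.functor.obj (ModuleCat.of K K)) := by
  have : Nontrivial (e.inverse.obj (𝟙_ C)) := by
    by_contra hV
    rw [not_nontrivial_iff_subsingleton] at hV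
    have h₁ : IsZero (𝟙_ C) :=
      ((e.functor.map_isZero (ModuleCat.isZero_of_subsingleton (e.inverse.obj (𝟙_ C)))).of_iso
        (e.counitIso.app _).symm)
    have h₂ := e.inverse.map_isZero (isZero_of_isZero_tensorUnit h₁
      (e.functor.obj (ModuleCat.of K K)))
    have h₃ := ModuleCat.subsingleton_of_isZero (h₂.of_iso (e.unitIso.app _))
    exact not_subsingleton K h₃
  obtain ⟨hK, ⟨l⟩⟩ := mul_comm_and_nonempty_linearEquiv_of_commute (K := K)
    (V := e.inverse.obj (𝟙_ C)) (fun f g => by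
      obtain ⟨f', hf⟩ := e.inverse.map_surjective (ModuleCat.ofHom f)
      obtain ⟨g', hg⟩ := e.inverse.map_surjective (ModuleCat.ofHom g)
      have := congr((e.inverse.map $(tensorUnit_hom_comm f' g')).hom)
      rw [Functor.map_comp, Functor.map_comp, hf, hg] at this
      exact this.symm)
  exact ⟨hK, ⟨(e.counitIso.app _).symm ≪≫ e.functor.mapIso l.symm.toModuleIso⟩⟩

end UnitOfModules

/-! ### Existence by transport of structure -/

section Transport

variable {C : Type u₁} [Category.{v₁} C] [Preadditive C] {D : Type u₂} [Category.{v₂} D]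
  [Preadditive D]

instance (e : C ≌ D) : Preadditive (Monoidal.Transported e) := inferInstanceAs (Preadditive D)

/-- Transport of an additive closed symmetric monoidal structure along an equivalence. -/
noncomputable def AdditiveClosedSymmetricMonoidal.transport
    (S : AdditiveClosedSymmetricMonoidal C) (e : C ≌ D) [e.functor.Additive] :
    AdditiveClosedSymmetricMonoidal D :=
  letI := S.monoidal
  letI := S.symmetric
  haveI := S.additive
  letI := S.closed.some
  haveI : (Monoidal.equivalenceTransported e).inverse.Additive := e.inverse_additive
  show AdditiveClosedSymmetricMonoidal (Monoidal.Transported e) from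
  { monoidal := Monoidal.Transported.instMonoidalCategory e
    symmetric := SymmetricCategory.ofFullyFaithful (Monoidal.equivalenceTransported e).inverse
    additive := monoidalPreadditive_of_faithful (Monoidal.equivalenceTransported e).inverse
    closed := ⟨inferInstanceAs (MonoidalClosed (Monoidal.Transported e))⟩ }

/-- The tensor product over a commutative ring. -/
noncomputable def AdditiveClosedSymmetricMonoidal.moduleCat (k : Type u) [CommRing k] :
    AdditiveClosedSymmetricMonoidal (ModuleCat.{u} k) where
  monoidal := inferInstance
  symmetric := inferInstance
  additive := inferInstance
  closed := ⟨inferInstance⟩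

end Transport

/-! ### Uniqueness, and the theorem -/

section Equivalent

theorem AdditiveClosedSymmetricMonoidal.equivalent_of_unitIso {C : Type u₁} [Category.{v₁} C]
    [Abelian C] [IsGrothendieckAbelian.{v₁} C] (S T : AdditiveClosedSymmetricMonoidal C)
    (i : T.monoidal.tensorUnit ≅ S.monoidal.tensorUnit)
    (h : IsSeparator S.monoidal.tensorUnit) : S.Equivalent T := by
  have h' : IsSeparator T.monoidal.tensorUnit := IsSeparator.of_iso h i.symm
  -- The identity functor suffices: the units are isomorphic generators.
  refine ⟨𝟭 C, inferInstance, inferInstance, ?_⟩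
  exact @nonempty_braided_of_unitIso C _ S.monoidal C _ T.monoidal (𝟭 C) T.closed.some _
    S.additive _ T.additive i S.closed.some S.symmetric T.symmetric _ _ h
    (isFullGenerator_of_isSeparator h) h' (isFullGenerator_of_isSeparator h')

end Equivalent

instance (R : Type u₁) (ι : Type v₁) [Ring R] [Fintype ι] [DecidableEq ι] :
    (ModuleCat.toMatrixModCat R ι).Additive where

theorem corollary3p4 (R : Type u) [Ring R] [IsSimpleRing R] [IsArtinianRing R] :
    (∃ (n : ℕ) (_ : NeZero n) (D : Type u) (_ : DivisionRing D),
      Nonempty (R ≃+* Matrix (Fin n) (Fin n) D)) ∧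
    ∀ (n : ℕ) (D : Type u) [DivisionRing D], (R ≃+* Matrix (Fin n) (Fin n) D) →
      ((∀ x y : D, x * y = y * x) →
        Nonempty (AdditiveClosedSymmetricMonoidal (ModuleCat.{u} R)) ∧
        ∀ S T : AdditiveClosedSymmetricMonoidal (ModuleCat.{u} R), S.Equivalent T) ∧
      ((¬ ∀ x y : D, x * y = y * x) →
        IsEmpty (AdditiveClosedSymmetricMonoidal (ModuleCat.{u} R))) := by
  refine ⟨IsSimpleRing.exists_ringEquiv_matrix_divisionRing R, fun n D _ φ => ?_⟩
  -- Matrices of size zero form the zero ring, which is not simple.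
  have hn : n ≠ 0 := by
    rintro rfl
    exact not_subsingleton R φ.toEquiv.subsingleton
  have : NeZero n := ⟨hn⟩
  let e : ModuleCat.{u} D ≌ ModuleCat.{u} R := (ModuleCat.matrixEquivalence D (0 : Fin n)).trans
    (ModuleCat.restrictScalarsEquivalenceOfRingEquiv φ)
  have : e.functor.Additive := inferInstanceAs
    (ModuleCat.toMatrixModCat D (Fin n) ⋙ ModuleCat.restrictScalars φ.toRingHom).Additive
  have unit (S : AdditiveClosedSymmetricMonoidal (ModuleCat.{u} R)) :=
    @mul_comm_and_nonempty_tensorUnit_iso D _ (ModuleCat.{u} R) _ _ S.monoidal S.additive e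
  refine ⟨fun hD => ⟨?_, fun S T => ?_⟩, fun hD => ⟨fun S => hD (unit S).1⟩⟩
  -- The commutative structure extends the given ring structure, so the category of `D`-modules is
  -- unchanged and `e` still applies.
  · let : CommRing D := { ‹DivisionRing D› with mul_comm := hD }
    exact ⟨(AdditiveClosedSymmetricMonoidal.moduleCat D).transport e⟩
  · obtain ⟨i⟩ := (unit S).2
    obtain ⟨j⟩ := (unit T).2
    exact S.equivalent_of_unitIso T (j ≪≫ i.symm)
      (IsSeparator.of_iso ((ModuleCat.isSeparator_self D).of_equivalence e) i.symm)
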